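/- A \emph{self-delimiting computer} is a partial computable function $C$ from finite bit strings (programs) to finite bit strings (outputs) whose domain (the set of programs that halt) is prefix-free: no halting program is a proper prefix of another halting program. A self-delimiting computer $U$ is \emph{universal} if for every self-delimiting computer $C$ there is a constant $c$ such that whenever $C(p)=x$ there is a program $q$ with $U(q)=x$ and $|q|\le |p|+c$, where $|p|$ is the size of $p$ in bits. Let $U$ be any universal self-delimiting computer. Then the series defining its halting probability \[ \Omega=\sum_{p\,:\,U(p)\text{ halts}} 2^{-|p|} \] converges, $0<\Omega<1$, and $\Omega$ is Borel normal in every base: for every integer $b\ge 2$, every $k\ge 0$ and every block $w=w_0\cdots w_{k-1}$ of $k$ base-$b$ digits, if $\Omega=0.d_0d_1d_2\ldots$ is the base-$b$ expansion of $\Omega$, then \[ \lim_{N\to\infty}\frac{\#\{\,0\le i<N : d_{i+j}=w_j \text{ for all } 0\le j<k\,\}}{N}=\frac1{b^k}. \] -/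

import Mathlib

/-- A self-delimiting computer: a partial computable function from programs (finite bit strings)
to outputs (finite bit strings), `C p` being defined exactly when the program `p` halts, such that
no halting program is a proper prefix of another one. -/
structure IsSelfDelimitingComputer (C : List Bool →. List Bool) : Prop where
  partrec : Partrec C
  prefixFree : ∀ p q : List Bool, (C p).Dom → (C q).Dom → p <+: q → p = q

/-- A universal (general-purpose) self-delimiting computer: it simulates every self-delimiting
computer `C` at the cost of at most a constant number of additional program bits, the constant
depending only on `C`. -/
structure IsUniversalComputer (U : List Bool →. List Bool) : Prop where
  selfDelimiting : IsSelfDelimitingComputer U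
  simulates : ∀ C : List Bool →. List Bool, IsSelfDelimitingComputer C →
    ∃ c : ℕ, ∀ p x : List Bool, x ∈ C p →
      ∃ q : List Bool, x ∈ U q ∧ q.length ≤ p.length + c

/-- The probability `1 / 2 ^ (size in bits of p)` of getting precisely the program `p` by
independent tosses of a fair coin, for each program `p` that halts on `U`. -/
noncomputable def programProbability (U : List Bool →. List Bool)
    (p : {p : List Bool // (U p).Dom}) : ℝ :=
  1 / 2 ^ p.1.length

/-- The halting probability `Ω = ∑ 1 / 2 ^ (size in bits of p)`, over all programs `p` that halt
on `U`. -/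
noncomputable def haltingProbability (U : List Bool →. List Bool) : ℝ :=
  ∑' p : {p : List Bool // (U p).Dom}, programProbability U p

/-- The number of starting positions `i < N` at which the block `w` of `k` digits occurs in the
infinite digit sequence `d` (overlapping occurrences are all counted). -/
def blockCount {b k : ℕ} (d : ℕ → Fin b) (w : Fin k → Fin b) (N : ℕ) : ℕ :=
  ((Finset.range N).filter fun i => ∀ j : Fin k, d (i + j) = w j).card

/-- `x ∈ [0, 1)` is `b`-normal: for every `k`, each of the `b ^ k` blocks of `k` successive digits
has limiting relative frequency `1 / b ^ k` in the base-`b` expansion of `x`. -/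
def IsNormalInBase (b : ℕ) [NeZero b] (x : ℝ) : Prop :=
  ∀ (k : ℕ) (w : Fin k → Fin b),
    Filter.Tendsto (fun N : ℕ => (blockCount (Real.digits x b) w N : ℝ) / (N : ℝ))
      Filter.atTop (nhds (1 / (b : ℝ) ^ k))

/-- `x ∈ [0, 1)` is Borel normal: it is `b`-normal for every base `b = 2, 3, 4, …` -/
def IsBorelNormal (x : ℝ) : Prop :=
  ∀ (b : ℕ) [NeZero b], 2 ≤ b → IsNormalInBase b x

/-!
The halting probability `Ω` is algorithmically random. For let a program of `n` bits describe a
rational `r < Ω`: running all `U`-programs in parallel until the weight of those that have halted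
exceeds `r`, one can output a string which none of these produces. A `U`-program for that string
has at most `n + O(1)` bits and has not been counted yet, hence `r + 2 ^ (-n - O(1)) ≤ Ω`.

Consequently, the first `T` digits of a random number cannot belong to a computable list of
exponentially small density, since such digits would have too short a description. By Chernoff's
bound the expansions in which some digit of base `B` is too frequent form such a list, so that every
digit has upper density at most `1 / B`. A block of `k` digits of `x` in base `b` at a position
congruent to `r` modulo `k` is a single digit of `b ^ r * x`, also random, in base `b ^ k`; so each
block has upper density at most `1 / b ^ k`. As the frequencies of the `b ^ k` blocks add up to `1`,
all of them have the limit `1 / b ^ k`.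
-/

open Filter
open scoped Topology

section KraftInequality

theorem uniquelyDecodable_of_isAntichain {α : Type*} {S : Set (List α)} (hnil : [] ∉ S)
    (hS : IsAntichain (· <+: ·) S) : InformationTheory.UniquelyDecodable S := by
  intro L₁
  induction L₁ with
  | nil =>
    rintro (_ | ⟨q, L₂⟩) _ h₂ h
    · rfl
    · obtain ⟨rfl, -⟩ : q = [] ∧ L₂.flatten = [] := by simpa using h
      exact absurd (h₂ [] (by simp)) hnil
  | cons p L₁ ih =>
    rintro (_ | ⟨q, L₂⟩) h₁ h₂ h
    · obtain ⟨rfl, -⟩ : p = [] ∧ L₁.flatten = [] := by simpa using h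
      exact absurd (h₁ [] (by simp)) hnil
    · rw [List.forall_mem_cons] at h₁ h₂
      rw [List.flatten_cons, List.flatten_cons] at h
      obtain rfl : p = q := by
        rcases List.prefix_or_prefix_of_prefix (h ▸ List.prefix_append p _)
          (List.prefix_append q _) with hpq | hqp
        · exact hS.eq h₁.1 h₂.1 hpq
        · exact (hS.eq h₂.1 h₁.1 hqp).symm
      rw [ih L₂ h₁.2 h₂.2 (List.append_cancel_left h)]

theorem kraft_inequality_of_isAntichain {α : Type*} [Fintype α] [Nonempty α]
    {S : Finset (List α)} (hS : IsAntichain (· <+: ·) (S : Set (List α))) :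
    ∑ p ∈ S, (1 / Fintype.card α : ℝ) ^ p.length ≤ 1 := by
  by_cases hnil : [] ∈ S
  · obtain rfl : S = {[]} :=
      Finset.eq_singleton_iff_unique_mem.2
        ⟨hnil, fun p hp => (hS.eq hnil hp List.nil_prefix).symm⟩
    simp
  · exact InformationTheory.kraft_mcmillan_inequality
      (uniquelyDecodable_of_isAntichain (by simpa using hnil) hS)

end KraftInequality

theorem programProbability_nonneg (U : List Bool →. List Bool)
    (p : {p : List Bool // (U p).Dom}) : 0 ≤ programProbability U p := by
  unfold programProbability
  positivity

namespace IsSelfDelimitingComputer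

variable {U : List Bool →. List Bool}

theorem isAntichain_dom (hU : IsSelfDelimitingComputer U) : IsAntichain (· <+: ·) U.Dom :=
  fun p hp q hq hne hpq => hne (hU.prefixFree p q hp hq hpq)

theorem sum_le_one (hU : IsSelfDelimitingComputer U)
    (F : Finset {p : List Bool // (U p).Dom}) : ∑ p ∈ F, programProbability U p ≤ 1 := by
  have hF : IsAntichain (· <+: ·) (F.map (Function.Embedding.subtype _) : Set (List Bool)) :=
    hU.isAntichain_dom.subset (Finset.map_subtype_subset F)
  simpa [programProbability] using kraft_inequality_of_isAntichain hF

theorem summable (hU : IsSelfDelimitingComputer U) : Summable (programProbability U) :=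
  summable_of_sum_le (programProbability_nonneg U) hU.sum_le_one

theorem haltingProbability_le_one (hU : IsSelfDelimitingComputer U) :
    haltingProbability U ≤ 1 :=
  hU.summable.tsum_le_of_sum_le hU.sum_le_one

theorem sum_le_haltingProbability (hU : IsSelfDelimitingComputer U) {S : Finset (List Bool)}
    (hS : (S : Set (List Bool)) ⊆ U.Dom) :
    ∑ p ∈ S, (1 : ℝ) / 2 ^ p.length ≤ haltingProbability U := by
  classical
  rw [← Finset.sum_subtype_of_mem (p := fun p => (U p).Dom)
    (fun p : List Bool => (1 : ℝ) / 2 ^ p.length) hS]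
  exact hU.summable.sum_le_tsum _ fun p _ => programProbability_nonneg U p

theorem exists_lt_sum_of_lt_haltingProbability (hU : IsSelfDelimitingComputer U) {r : ℝ}
    (hr : r < haltingProbability U) :
    ∃ S : Finset (List Bool), (S : Set (List Bool)) ⊆ U.Dom ∧
      r < ∑ p ∈ S, (1 : ℝ) / 2 ^ p.length := by
  obtain ⟨F, hF⟩ := (hU.summable.hasSum.eventually (lt_mem_nhds hr)).exists
  exact ⟨F.map (Function.Embedding.subtype _), Finset.map_subtype_subset F, by
    simpa [programProbability] using hF⟩

theorem haltingProbability_pos (hU : IsSelfDelimitingComputer U) (hdom : U.Dom.Nonempty) :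
    0 < haltingProbability U := by
  obtain ⟨p, hp⟩ := hdom
  have h := hU.sum_le_haltingProbability (S := {p}) (by simpa using hp)
  exact lt_of_lt_of_le (by simp) h

end IsSelfDelimitingComputer

section Primrec

variable {α β : Type*} [Primcodable α] [Primcodable β]

theorem primrec_nat_pow : Primrec₂ ((· ^ ·) : ℕ → ℕ → ℕ) :=
  Primrec₂.unpaired'.1 Nat.Primrec.pow

theorem primrec_nat_log {b : ℕ} (hb : 1 < b) : Primrec (Nat.log b) := by
  refine (Primrec.nat_findGreatest (p := fun n k => b ^ k ≤ n) Primrec.id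
    (Primrec.nat_le.comp (primrec_nat_pow.comp (Primrec.const b) Primrec.snd)
      Primrec.fst)).of_eq fun n => ?_
  refine Nat.findGreatest_eq_iff.2 ⟨Nat.log_le_self b n, fun h => ?_, fun k hk _ => ?_⟩
  · exact Nat.pow_log_le_self b fun hn => h (by simp [hn])
  · exact (Nat.lt_pow_of_log_lt hb hk).not_ge

theorem primrec_nat_count {n : α → ℕ} {p : α → ℕ → Prop} [DecidableRel p] (hn : Primrec n)
    (hp : PrimrecRel p) : Primrec fun a => Nat.count (p a) (n a) := by
  refine (Primrec.nat_rec' (h := fun a (z : ℕ × ℕ) => z.2 + if p a z.1 then 1 else 0) hn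
    (Primrec.const 0) ?_).of_eq fun a => ?_
  · exact Primrec.nat_add.comp (Primrec.snd.comp Primrec.snd) (Primrec.ite
      (hp.comp Primrec.fst (Primrec.fst.comp Primrec.snd)) (Primrec.const 1) (Primrec.const 0))
  · induction n a with
    | zero => rfl
    | succ k ih => rw [Nat.count_succ, ← ih]

theorem primrec_list_filter {f : α → List β} {p : α → β → Prop} [DecidableRel p]
    (hf : Primrec f) (hp : PrimrecRel p) : Primrec fun a => (f a).filter fun b => p a b := by
  refine (Primrec.listFilterMap (g := fun a b => if p a b then some b else none) hf
    (Primrec.ite hp (Primrec.option_some.comp Primrec.snd) (Primrec.const none))).of_eq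
      fun a => ?_
  rw [← List.filterMap_eq_filter]
  exact List.filterMap_congr fun b _ => by simp [Option.guard]

theorem primrec_list_sum : Primrec (List.sum : List ℕ → ℕ) :=
  Primrec.list_foldr (h := fun _ (z : ℕ × ℕ) => z.1 + z.2) Primrec.id (Primrec.const 0)
    (Primrec.nat_add.comp (Primrec.fst.comp Primrec.snd) (Primrec.snd.comp Primrec.snd))

theorem primrec_ofDigits_toNat (b : ℕ) :
    Primrec fun p : List Bool => Nat.ofDigits b (p.map Bool.toNat) := by
  refine (Primrec.list_foldr (h := fun _ (z : Bool × ℕ) => z.1.toNat + b * z.2) Primrec.id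
    (Primrec.const 0) (Primrec.nat_add.comp ?_ ?_)).of_eq fun p => ?_
  · exact (Primrec.dom_finite Bool.toNat).comp (Primrec.fst.comp Primrec.snd)
  · exact Primrec.nat_mul.comp (Primrec.const b) (Primrec.snd.comp Primrec.snd)
  · rw [Nat.ofDigits_eq_foldr, List.foldr_map]
    rfl

end Primrec

section StageEnumeration

variable {α β : Type*} [Primcodable α] [Primcodable β]

/-- A primitive recursive enumeration in stages of the graph of a partial function `f`: the finite
list `e s` contains the pairs found up to stage `s`, all with first component of code less
than `s`, and each pair of the graph belongs to all late enough stages. -/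
structure IsStageEnumeration (f : α →. β) (e : ℕ → List (α × β)) : Prop where
  primrec : Primrec e
  nodup_fst : ∀ s, ((e s).map Prod.fst).Nodup
  encode_lt : ∀ {s a b}, (a, b) ∈ e s → Encodable.encode a < s
  sound : ∀ {s a b}, (a, b) ∈ e s → b ∈ f a
  complete : ∀ {a b}, b ∈ f a → ∀ᶠ s in atTop, (a, b) ∈ e s

/-- The pair `(a, b)`, where `a` has code `n`, if the program `c` started on `n` outputs the code
of `b` within fuel `s`. -/
def graphPoint (c : Nat.Partrec.Code) (s n : ℕ) : Option (α × β) :=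
  (Encodable.decode₂ α n).bind fun a =>
    (c.evaln s n).bind fun y => (Encodable.decode₂ β y).map fun b => (a, b)

theorem graphPoint_eq_some {c : Nat.Partrec.Code} {s n : ℕ} {a : α} {b : β} :
    graphPoint c s n = some (a, b) ↔
      Encodable.encode a = n ∧ Encodable.encode b ∈ c.evaln s n := by
  simp only [graphPoint, Option.bind_eq_some_iff, Option.map_eq_some_iff, Prod.mk.injEq,
    Encodable.decode₂_eq_some]
  constructor
  · rintro ⟨_, rfl, _, hy, _, rfl, rfl, rfl⟩
    exact ⟨rfl, hy⟩
  · rintro ⟨rfl, hb⟩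
    exact ⟨a, rfl, _, hb, b, rfl, rfl, rfl⟩

theorem primrec_graphPoint (c : Nat.Partrec.Code) :
    Primrec₂ (graphPoint c : ℕ → ℕ → Option (α × β)) := by
  refine Primrec.option_bind (Primrec.decode₂.comp Primrec.snd) (Primrec.option_bind
    (Nat.Partrec.Code.primrec_evaln.comp
      (((Primrec.fst.comp Primrec.fst).pair (Primrec.const c)).pair
        (Primrec.snd.comp Primrec.fst)))
    (Primrec.option_map (Primrec.decode₂.comp Primrec.snd) ?_))
  exact (Primrec.snd.comp (Primrec.fst.comp Primrec.fst)).pair Primrec.snd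

theorem exists_isStageEnumeration {f : α →. β} (hf : Partrec f) :
    ∃ e, IsStageEnumeration f e := by
  obtain ⟨c, hc⟩ := Nat.Partrec.Code.exists_code.1 hf
  have mem_eval_iff (a : α) (b : β) :
      Encodable.encode b ∈ c.eval (Encodable.encode a) ↔ b ∈ f a := by
    simp [hc]
  have mem_iff {s : ℕ} {a : α} {b : β} :
      (a, b) ∈ (List.range s).filterMap (graphPoint c s) ↔
        Encodable.encode b ∈ c.evaln s (Encodable.encode a) := by
    simp only [List.mem_filterMap, graphPoint_eq_some, List.mem_range]
    constructor
    · rintro ⟨_, -, rfl, hb⟩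
      exact hb
    · exact fun hb => ⟨_, Nat.Partrec.Code.evaln_bound hb, rfl, hb⟩
  refine ⟨fun s => (List.range s).filterMap (graphPoint c s),
    Primrec.listFilterMap Primrec.list_range (primrec_graphPoint c), fun s => ?_,
    fun h => Nat.Partrec.Code.evaln_bound (mem_iff.1 h),
    fun h => (mem_eval_iff _ _).1 (Nat.Partrec.Code.evaln_sound (mem_iff.1 h)), fun {a b} h => ?_⟩
  · rw [List.map_filterMap]
    refine List.nodup_range.filterMap fun n n' a hn hn' => ?_
    simp only [Option.mem_def, Option.map_eq_some_iff, Prod.exists, exists_and_right,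
      exists_eq_right, graphPoint_eq_some] at hn hn'
    obtain ⟨⟨_, rfl, -⟩, ⟨_, rfl, -⟩⟩ := And.intro hn hn'
    rfl
  · obtain ⟨s₀, hs₀⟩ := Nat.Partrec.Code.evaln_complete.1 ((mem_eval_iff a b).2 h)
    exact (eventually_ge_atTop s₀).mono fun s hs =>
      mem_iff.2 (Nat.Partrec.Code.evaln_mono hs hs₀)

end StageEnumeration

/-- The total weight `∑ 1 / 2 ^ (size in bits of p)` of the programs of a list, in units of
`1 / 2 ^ s`; it is exact when all these programs have at most `s` bits. -/
def stageWeight (s : ℕ) (l : List (List Bool)) : ℕ :=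
  (l.map fun p => 2 ^ (s - p.length)).sum

theorem stageWeight_div {s : ℕ} {l : List (List Bool)} (hl : ∀ p ∈ l, p.length ≤ s) :
    (stageWeight s l : ℝ) / 2 ^ s = (l.map fun p => (1 : ℝ) / 2 ^ p.length).sum := by
  rw [stageWeight, Nat.cast_list_sum, List.map_map, div_eq_mul_inv, ← List.sum_map_mul_right]
  refine congrArg List.sum (List.map_congr_left fun p hp => ?_)
  simp [pow_sub₀ (2 : ℝ) two_ne_zero (hl p hp), mul_comm]

theorem primrec_stageWeight : Primrec₂ stageWeight :=
  primrec_list_sum.comp (Primrec.list_map Primrec.snd (primrec_nat_pow.comp (Primrec.const 2)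
    (Primrec.nat_sub.comp (Primrec.fst.comp Primrec.fst)
      (Primrec.list_length.comp Primrec.snd))))

namespace IsStageEnumeration

variable {U : List Bool →. List Bool} {e : ℕ → List (List Bool × List Bool)}

theorem mem_dom (he : IsStageEnumeration U e) {s : ℕ} {p : List Bool}
    (hp : p ∈ (e s).map Prod.fst) : p ∈ U.Dom := by
  obtain ⟨⟨p, x⟩, hpx, rfl⟩ := List.mem_map.1 hp
  exact Part.dom_iff_mem.2 ⟨x, he.sound hpx⟩

theorem eventually_subset (he : IsStageEnumeration U e) {S : Finset (List Bool)}
    (hS : (S : Set (List Bool)) ⊆ U.Dom) :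
    ∀ᶠ s in atTop, S ⊆ ((e s).map Prod.fst).toFinset := by
  refine (eventually_all_finset S).2 fun p hp => ?_
  filter_upwards [he.complete (Part.get_mem (hS hp))] with s hs
  exact List.mem_toFinset.2 (List.mem_map_of_mem hs)

theorem stageWeight_div_eq_sum (he : IsStageEnumeration U e) (s : ℕ) :
    (stageWeight s ((e s).map Prod.fst) : ℝ) / 2 ^ s =
      ∑ p ∈ ((e s).map Prod.fst).toFinset, (1 : ℝ) / 2 ^ p.length := by
  rw [List.sum_toFinset _ (he.nodup_fst s), stageWeight_div]
  rintro _ hp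
  obtain ⟨⟨p, x⟩, hpx, rfl⟩ := List.mem_map.1 hp
  exact (Encodable.length_le_encode p).trans (he.encode_lt hpx).le

theorem exists_lt_stageWeight (he : IsStageEnumeration U e) (hU : IsSelfDelimitingComputer U)
    {r : ℝ} (hr : r < haltingProbability U) :
    ∃ s, r < stageWeight s ((e s).map Prod.fst) / 2 ^ s := by
  obtain ⟨S, hS, hrS⟩ := hU.exists_lt_sum_of_lt_haltingProbability hr
  obtain ⟨s, hs⟩ := (he.eventually_subset hS).exists
  refine ⟨s, hrS.trans_le ?_⟩
  rw [he.stageWeight_div_eq_sum]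
  exact Finset.sum_le_sum_of_subset_of_nonneg hs fun _ _ _ => by positivity

theorem stageWeight_add_le (he : IsStageEnumeration U e) (hU : IsSelfDelimitingComputer U)
    {s : ℕ} {q : List Bool} (hq : q ∈ U.Dom) (hqs : q ∉ (e s).map Prod.fst) :
    stageWeight s ((e s).map Prod.fst) / 2 ^ s + 1 / 2 ^ q.length ≤ haltingProbability U := by
  rw [he.stageWeight_div_eq_sum, add_comm,
    ← Finset.sum_insert (f := fun p => (1 : ℝ) / 2 ^ p.length)
      fun h => hqs (List.mem_toFinset.1 h)]
  refine hU.sum_le_haltingProbability fun p hp => ?_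
  rcases Finset.mem_insert.1 hp with rfl | hp
  · exact hq
  · exact he.mem_dom (List.mem_toFinset.1 hp)

end IsStageEnumeration

theorem cons_flatten_notMem {α : Type*} (a : α) (l : List (List α)) : a :: l.flatten ∉ l :=
  fun h => absurd (List.sublist_flatten_of_mem h).length_le (by simp)

theorem IsSelfDelimitingComputer.exists_stage_approximation {U : List Bool →. List Bool}
    (hU : IsSelfDelimitingComputer U) :
    ∃ (ω : ℕ → ℕ) (z : ℕ → List Bool), Primrec ω ∧ Primrec z ∧
      (∀ r < haltingProbability U, ∃ s, r < ω s / 2 ^ s) ∧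
      ∀ s q, z s ∈ U q → (ω s / 2 ^ s + 1 / 2 ^ q.length : ℝ) ≤ haltingProbability U := by
  obtain ⟨e, he⟩ := exists_isStageEnumeration hU.partrec
  refine ⟨fun s => stageWeight s ((e s).map Prod.fst),
    fun s => false :: ((e s).map Prod.snd).flatten,
    primrec_stageWeight.comp Primrec.id
      (Primrec.list_map he.primrec (Primrec.fst.comp Primrec.snd)),
    Primrec.list_cons.comp (Primrec.const false)
      (Primrec.list_flatten.comp (Primrec.list_map he.primrec (Primrec.snd.comp Primrec.snd))),
    fun r hr => he.exists_lt_stageWeight hU hr, fun s q hq => ?_⟩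
  refine he.stageWeight_add_le hU (Part.dom_iff_mem.2 ⟨_, hq⟩) fun hqs => ?_
  obtain ⟨⟨q, x⟩, hqx, rfl⟩ := List.mem_map.1 hqs
  obtain rfl := Part.mem_unique (he.sound hqx) hq
  exact cons_flatten_notMem _ _ (List.mem_map_of_mem (f := Prod.snd) hqx)

/-- A real number `x` is algorithmically random (Chaitin, Levin) when self-delimiting descriptions
of rational numbers cannot approximate it well: for every self-delimiting computer `t` whose
outputs `(A, B)` stand for the rational `A / B`, the rationals below `x` described by programs of
`n` bits stay at distance at least `2 ^ (-n - c)` from `x`. Only approximations from below by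
nonnegative rationals are considered. -/
def IsAlgorithmicallyRandom (x : ℝ) : Prop :=
  ∀ t : List Bool →. ℕ × ℕ, Partrec t → IsAntichain (· <+: ·) t.Dom →
    ∃ c : ℕ, ∀ p A B, (A, B) ∈ t p → 0 < B → (A / B : ℝ) < x →
      (A / B : ℝ) + 1 / 2 ^ (p.length + c) ≤ x

namespace IsUniversalComputer

variable {U : List Bool →. List Bool}

theorem dom_nonempty (hU : IsUniversalComputer U) : U.Dom.Nonempty := by
  have hC : IsSelfDelimitingComputer fun p => if p = [] then Part.some [] else Part.none := by
    refine ⟨?_, fun p q hp hq _ => ?_⟩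
    · refine (Computable.ofOption (f := fun p : List Bool => if p = [] then some [] else none)
        (Primrec.ite (Primrec.eq.comp Primrec.id (Primrec.const []))
          (Primrec.const (some [])) (Primrec.const none)).to_comp).of_eq fun p => ?_
      split_ifs <;> rfl
    · have dom_eq {r : List Bool}
          (hr : (if r = [] then Part.some [] else Part.none : Part (List Bool)).Dom) : r = [] := by
        by_contra h
        simp [h] at hr
      rw [dom_eq hp, dom_eq hq]
  obtain ⟨c, hc⟩ := hU.simulates _ hC
  obtain ⟨q, hq, -⟩ := hc [] [] (by simp)
  exact ⟨q, Part.dom_iff_mem.2 ⟨_, hq⟩⟩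

theorem isAlgorithmicallyRandom (hU : IsUniversalComputer U) :
    IsAlgorithmicallyRandom (haltingProbability U) := by
  intro t ht htpf
  obtain ⟨ω, z, hω, hz, hlim, hgap⟩ := hU.selfDelimiting.exists_stage_approximation
  let exceeds (r : ℕ × ℕ) (s : ℕ) : Bool := decide (r.1 * 2 ^ s < ω s * r.2)
  let C : List Bool →. List Bool := fun p =>
    (t p).bind fun r => (Nat.rfind fun s => Part.some (exceeds r s)).map z
  have hexceeds : Primrec₂ exceeds := (Primrec.nat_lt.comp
    (Primrec.nat_mul.comp (Primrec.fst.comp Primrec.fst)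
      (primrec_nat_pow.comp (Primrec.const 2) Primrec.snd))
    (Primrec.nat_mul.comp (hω.comp Primrec.snd) (Primrec.snd.comp Primrec.fst))).decide
  have hC : IsSelfDelimitingComputer C := by
    refine ⟨?_, fun p q hp hq hpq => htpf.eq hp.1 hq.1 hpq⟩
    refine ht.bind (Partrec.map (Partrec.rfind ?_) (hz.to_comp.comp Computable.snd))
    exact (hexceeds.comp (Primrec.snd.comp Primrec.fst) Primrec.snd).to_comp.partrec
  obtain ⟨c, hc⟩ := hU.simulates C hC
  refine ⟨c, fun p A B hp hB hlt => ?_⟩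
  have exceeds_iff (s : ℕ) : exceeds (A, B) s = true ↔ (A / B : ℝ) < ω s / 2 ^ s := by
    rw [decide_eq_true_iff, div_lt_div_iff₀ (by exact_mod_cast hB) (by positivity)]
    norm_cast
  obtain ⟨s₀, hs₀⟩ := hlim _ hlt
  obtain ⟨s, hs, -⟩ := Nat.rfind_min' ((exceeds_iff s₀).2 hs₀)
  have hωs : (A / B : ℝ) < ω s / 2 ^ s := (exceeds_iff s).1 (by simpa using Nat.rfind_spec hs)
  obtain ⟨q, hq, hqlen⟩ := hc p (z s) (Part.mem_bind hp (Part.mem_map z hs))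
  calc (A / B : ℝ) + 1 / 2 ^ (p.length + c) ≤ ω s / 2 ^ s + 1 / 2 ^ q.length := by
        gcongr
        norm_num
    _ ≤ haltingProbability U := hgap s q hq

end IsUniversalComputer

theorem IsAlgorithmicallyRandom.natCast_mul {x : ℝ} (hx : IsAlgorithmicallyRandom x) {D : ℕ}
    (hD : 0 < D) : IsAlgorithmicallyRandom (D * x) := by
  intro t ht htpf
  obtain ⟨c, hc⟩ := hx (fun p => (t p).map fun r => (r.1, r.2 * D))
    (ht.map ((Primrec.fst.comp Primrec.snd).pair (Primrec.nat_mul.comp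
      (Primrec.snd.comp Primrec.snd) (Primrec.const D))).to_comp.to₂) htpf
  refine ⟨c, fun p A B hp hB hlt => ?_⟩
  have hD' : (1 : ℝ) ≤ D := by exact_mod_cast hD
  have h := hc p A (B * D) (Part.mem_map _ hp) (by positivity)
    (by rw [Nat.cast_mul, ← div_div, div_lt_iff₀' (by positivity)]; exact hlt)
  calc (A / B : ℝ) + 1 / 2 ^ (p.length + c)
      ≤ A / B + D * (1 / 2 ^ (p.length + c)) := by
        gcongr
        exact le_mul_of_one_le_left (by positivity) hD'
    _ = D * (A / (B * D : ℕ) + 1 / 2 ^ (p.length + c)) := by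
        push_cast
        field_simp
    _ ≤ D * x := by gcongr

section PrefixFreeCode

theorem eq_of_prefix_of_length_eq_idxOf {α : Type*} [DecidableEq α] {a : α} {g : ℕ → ℕ}
    {p q : List α} (hap : a ∈ p) (hp : p.length = g (p.idxOf a)) (hq : q.length = g (q.idxOf a))
    (hpq : p <+: q) : p = q := by
  refine hpq.eq_of_length ?_
  obtain ⟨r, rfl⟩ := hpq
  rw [hp, hq, List.idxOf_append_of_mem hap]

theorem exists_ofDigits_toNat_eq (n : ℕ) :
    ∀ i < 2 ^ n, ∃ p : List Bool, p.length = n ∧ Nat.ofDigits 2 (p.map Bool.toNat) = i := by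
  induction n with
  | zero => exact fun i hi => ⟨[], rfl, by simpa [eq_comm] using hi⟩
  | succ n ih =>
    intro i hi
    obtain ⟨p, hp, hpi⟩ := ih (i / 2) (by omega)
    refine ⟨decide (i % 2 = 1) :: p, by simp [hp], ?_⟩
    rw [List.map_cons, Nat.ofDigits_cons, hpi]
    rcases Nat.mod_two_eq_zero_or_one i with h | h <;> simp [h] <;> omega

/-- The self-delimiting code of a pair `(m, i)` with `i < 2 ^ ℓ m` consists of `m` in unary
followed by the `ℓ m` binary digits of `i`. -/
theorem exists_prefixFree_code {ℓ : ℕ → ℕ} (hℓ : Computable ℓ) :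
    ∃ d : List Bool → Option (ℕ × ℕ), Computable d ∧
      IsAntichain (· <+: ·) {p | (d p).isSome} ∧
      ∀ m i, i < 2 ^ ℓ m → ∃ p, p.length = m + ℓ m + 1 ∧ d p = some (m, i) := by
  let m (p : List Bool) : ℕ := p.idxOf false
  let i (p : List Bool) : ℕ := Nat.ofDigits 2 ((p.drop (m p + 1)).map Bool.toNat)
  have hm : Primrec m := Primrec.list_idxOf.comp (Primrec.const false) Primrec.id
  have hi : Primrec i :=
    (primrec_ofDigits_toNat 2).comp (Primrec.list_drop.comp (Primrec.succ.comp hm) Primrec.id)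
  refine ⟨fun p => bif p.length == m p + ℓ (m p) + 1 then some (m p, i p) else none, ?_,
    fun p hp q hq hne hpq => ?_, fun k j hj => ?_⟩
  · exact Computable.cond
      (Primrec.beq.to_comp.comp Primrec.list_length.to_comp (Primrec.succ.to_comp.comp
        (Primrec.nat_add.to_comp.comp hm.to_comp (hℓ.comp hm.to_comp))))
      (Primrec.option_some.comp (hm.pair hi)).to_comp (Computable.const none)
  · simp only [Set.mem_ofPred_eq, cond_eq_ite, beq_iff_eq, Option.isSome_ite] at hp hq
    refine hne (eq_of_prefix_of_length_eq_idxOf (g := fun m => m + ℓ m + 1) (a := false)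
      ?_ hp hq hpq)
    exact List.idxOf_lt_length_iff.1 (show m p < p.length by omega)
  · obtain ⟨p, hp, rfl⟩ := exists_ofDigits_toNat_eq (ℓ k) j hj
    have hidx : (List.replicate k true ++ false :: p).idxOf false = k := by
      rw [List.idxOf_append_of_notMem (by simp)]
      simp
    refine ⟨List.replicate k true ++ false :: p, by simp [hp, add_assoc], ?_⟩
    simp [m, i, hidx, hp, add_assoc, List.drop_append]

end PrefixFreeCode

/-- The `i`-th entry of `L m` is described by the code of `(m, i)`, which has
`m + log₂ (L m).length + O(1)` bits. -/
theorem IsAlgorithmicallyRandom.exists_add_le_of_mem {x : ℝ} (hx : IsAlgorithmicallyRandom x)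
    {L : ℕ → List (ℕ × ℕ)} (hL : Computable L) :
    ∃ c : ℕ, ∀ m A B, (A, B) ∈ L m → 0 < B → (A / B : ℝ) < x →
      (A / B : ℝ) + 1 / (2 ^ (m + c) * (L m).length) ≤ x := by
  let ℓ (m : ℕ) : ℕ := Nat.log 2 (L m).length + 1
  have hℓ : Computable ℓ := Computable.succ.comp
    ((primrec_nat_log one_lt_two).to_comp.comp (Computable.list_length.comp hL))
  obtain ⟨d, hd, hpf, hcode⟩ := exists_prefixFree_code hℓ
  let t (p : List Bool) : Option (ℕ × ℕ) := (d p).bind fun z => (L z.1)[z.2]?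
  have ht : Computable t := Computable.option_bind hd (Primrec.list_getElem?.to_comp.comp
    (hL.comp (Computable.fst.comp Computable.snd)) (Computable.snd.comp Computable.snd))
  have htdom : PFun.Dom (fun p => (t p : Part (ℕ × ℕ))) ⊆ {p | (d p).isSome} := fun p hp =>
    Option.isSome_of_isSome_bind (Part.ofOption_dom _ |>.1 hp)
  obtain ⟨c, hc⟩ := hx (fun p => t p) ht.ofOption (hpf.subset htdom)
  refine ⟨c + 2, fun m A B hAB hB hlt => ?_⟩
  obtain ⟨i, hi, hiAB⟩ := List.getElem_of_mem hAB
  obtain ⟨p, hp, hdp⟩ := hcode m i (hi.trans (Nat.lt_pow_succ_log_self one_lt_two _))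
  have h := hc p A B (by simp [t, hdp, hi, hiAB]) hB hlt
  have hℓle : (2 : ℝ) ^ Nat.log 2 (L m).length ≤ (L m).length := by
    exact_mod_cast Nat.pow_log_le_self 2 (by omega)
  refine le_trans ?_ h
  have : (2 : ℝ) ^ (p.length + c) = 2 ^ (m + (c + 2)) * 2 ^ Nat.log 2 (L m).length := by
    simp only [hp, ℓ, ← pow_add]
    congr 1
    omega
  rw [this]
  gcongr

/-- The rationals `(a * 4 ^ m - 1) / (d * 4 ^ m)` have descriptions of `m + O(1)` bits and are too
close to `a / d`. -/
theorem IsAlgorithmicallyRandom.irrational {x : ℝ} (hx : IsAlgorithmicallyRandom x)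
    (h0 : 0 < x) : Irrational x := by
  rintro ⟨r, rfl⟩
  obtain ⟨a, ha⟩ := Int.eq_ofNat_of_zero_le (Rat.num_nonneg.2 (Rat.cast_pos.1 h0).le)
  have ha0 : 0 < a := by
    exact_mod_cast ha ▸ Rat.num_pos.2 (Rat.cast_pos.1 h0)
  have hr : (r : ℝ) = a / r.den := by
    rw [Rat.cast_def, ha, Int.cast_natCast]
  have hden : 0 < r.den := r.den_pos
  have hfour : Primrec fun m : ℕ => 4 ^ m := primrec_nat_pow.comp (Primrec.const 4) Primrec.id
  have hL : Primrec fun m => [(a * 4 ^ m - 1, r.den * 4 ^ m)] := Primrec.list_cons.comp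
    ((Primrec.nat_sub.comp (Primrec.nat_mul.comp (Primrec.const a) hfour) (Primrec.const 1)).pair
      (Primrec.nat_mul.comp (Primrec.const r.den) hfour)) (Primrec.const [])
  obtain ⟨c, hc⟩ := hx.exists_add_le_of_mem hL.to_comp
  have below : ((a * 4 ^ (c + 1) - 1 : ℕ) / (r.den * 4 ^ (c + 1) : ℕ) : ℝ) =
      r - 1 / (r.den * 4 ^ (c + 1)) := by
    rw [hr, Nat.cast_sub (Nat.one_le_iff_ne_zero.2 (by positivity))]
    push_cast
    field_simp
  have h := hc (c + 1) _ _ List.mem_cons_self (by positivity)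
    (by rw [below]; exact sub_lt_self _ (by positivity))
  have hpow : (2 : ℝ) ^ (c + 1 + c) < r.den * 4 ^ (c + 1) := by
    calc (2 : ℝ) ^ (c + 1 + c) < 2 ^ (2 * (c + 1)) :=
        pow_lt_pow_right₀ one_lt_two (by omega)
      _ = 4 ^ (c + 1) := by rw [pow_mul]; norm_num
      _ ≤ r.den * 4 ^ (c + 1) :=
        le_mul_of_one_le_left (by positivity) (by exact_mod_cast hden)
  rw [below, List.length_singleton, Nat.cast_one, mul_one] at h
  linarith [one_div_lt_one_div_of_lt (by positivity) hpow]

theorem IsAlgorithmicallyRandom.eventually_floor_mod_notMem {x : ℝ}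
    (hx : IsAlgorithmicallyRandom x) (h0 : 0 < x) {E : ℕ → List ℕ} {N : ℕ → ℕ} (hE : Primrec E)
    (hN : Primrec N) (hN0 : ∀ m, 0 < N m) (hsmall : ∀ m, 4 ^ m * (E m).length ≤ N m) :
    ∀ᶠ m in atTop, ⌊x * N m⌋₊ % N m ∉ E m := by
  -- The integer part of `x` is hard-coded, so that `E m` only has to list residues.
  obtain ⟨c, hc⟩ := hx.exists_add_le_of_mem (L := fun m =>
    (E m).map fun a => (N m * ⌊x⌋₊ + a, N m)) (Primrec.list_map hE
      ((Primrec.nat_add.comp (Primrec.nat_mul.comp (hN.comp Primrec.fst) (Primrec.const ⌊x⌋₊))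
        Primrec.snd).pair (hN.comp Primrec.fst)).to₂).to_comp
  filter_upwards [eventually_ge_atTop c] with m hm hmem
  have hNm : (0 : ℝ) < N m := by exact_mod_cast hN0 m
  have hdecomp : N m * ⌊x⌋₊ + ⌊x * N m⌋₊ % N m = ⌊x * N m⌋₊ := by
    rw [← Nat.cast_mul_floor_div_cancel (a := x) (hN0 m).ne', mul_comm x]
    exact Nat.div_add_mod _ _
  have hlt : (⌊x * N m⌋₊ : ℝ) < x * N m := by
    refine (Nat.floor_le (by positivity)).lt_of_ne fun h => ?_
    exact ((hx.irrational h0).mul_natCast (hN0 m).ne').ne_nat _ h.symm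
  have hgap := hc m _ _ (List.mem_map_of_mem hmem) (hN0 m)
    (by rwa [hdecomp, div_lt_iff₀ hNm])
  rw [hdecomp, List.length_map] at hgap
  have hlen : (0 : ℝ) < (E m).length := by exact_mod_cast List.length_pos_of_mem hmem
  have hcard : (2 : ℝ) ^ (m + c) * (E m).length ≤ N m := by
    calc (2 : ℝ) ^ (m + c) * (E m).length ≤ 2 ^ (m + m) * (E m).length := by gcongr; norm_num
      _ = 4 ^ m * (E m).length := by rw [← two_mul, pow_mul]; norm_num
      _ ≤ N m := by exact_mod_cast hsmall m
  refine lt_irrefl x ?_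
  calc x < (⌊x * N m⌋₊ + 1) / N m := (lt_div_iff₀ hNm).2 (Nat.lt_floor_add_one _)
    _ = ⌊x * N m⌋₊ / N m + 1 / N m := add_div _ _ _
    _ ≤ ⌊x * N m⌋₊ / N m + 1 / (2 ^ (m + c) * (E m).length) := by gcongr
    _ ≤ x := hgap

section DigitCount

/-- The number of occurrences of the digit `v` among the last `T` digits of the base-`B` expansion
of the natural number `a`, padded by zeros on the left. -/
def digitCount (B v T a : ℕ) : ℕ :=
  Nat.count (fun j => a / B ^ j % B = v) T

theorem digitCount_succ (B v T a : ℕ) :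
    digitCount B v (T + 1) a = digitCount B v T (a / B) + if a % B = v then 1 else 0 := by
  simp [digitCount, Nat.count_succ', pow_succ', Nat.div_div_eq_div_mul]

theorem digitCount_mod (B v T a : ℕ) :
    digitCount B v T (a % B ^ T) = digitCount B v T a := by
  induction T generalizing a with
  | zero => rfl
  | succ T ih =>
    rw [digitCount_succ, digitCount_succ, pow_succ', Nat.mod_mul_right_div_self, ih,
      Nat.mod_mul_right_mod]

theorem floor_mul_pow_succ_div (x : ℝ) (B : ℕ) [NeZero B] (n : ℕ) :
    ⌊x * (B : ℝ) ^ (n + 1)⌋₊ / B = ⌊x * (B : ℝ) ^ n⌋₊ := by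
  rw [← Nat.floor_div_natCast, pow_succ, ← mul_assoc,
    mul_div_cancel_right₀ _ (NeZero.ne (B : ℝ))]

theorem digitCount_floor (x : ℝ) {B : ℕ} [NeZero B] (v : Fin B) (T : ℕ) :
    digitCount B v T ⌊x * B ^ T⌋₊ = Nat.count (fun t => Real.digits x B t = v) T := by
  induction T with
  | zero => rfl
  | succ T ih =>
    rw [digitCount_succ, Nat.count_succ, floor_mul_pow_succ_div, ih]
    simp only [Fin.ext_iff]
    rfl

theorem primrec_digitCount (B v : ℕ) : Primrec₂ (digitCount B v) :=
  primrec_nat_count (p := fun (z : ℕ × ℕ) j => z.2 / B ^ j % B = v) Primrec.fst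
    (Primrec.eq.comp (Primrec.nat_mod.comp (Primrec.nat_div.comp
      (Primrec.snd.comp Primrec.fst) (primrec_nat_pow.comp (Primrec.const B) Primrec.snd))
      (Primrec.const B)) (Primrec.const v))

theorem sum_range_mul_eq {M : Type*} [AddCommMonoid M] (f : ℕ → M) (n B : ℕ) :
    ∑ a ∈ Finset.range (n * B), f a =
      ∑ i ∈ Finset.range n, ∑ r ∈ Finset.range B, f (B * i + r) := by
  induction n with
  | zero => simp
  | succ n ih => rw [Nat.succ_mul, Finset.sum_range_add, ih, Finset.sum_range_succ, mul_comm]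

theorem sum_pow_digitCount {R : Type*} [CommRing R] {B v : ℕ} (hv : v < B) (x : R) (T : ℕ) :
    ∑ a ∈ Finset.range (B ^ T), x ^ digitCount B v T a = (B - 1 + x) ^ T := by
  have hB : 0 < B := by omega
  induction T with
  | zero => simp [digitCount]
  | succ T ih =>
    have sum_digit : ∑ r ∈ Finset.range B, x ^ (if r = v then 1 else 0) = B - 1 + x := by
      rw [← Finset.add_sum_erase _ _ (Finset.mem_range.2 hv),
        Finset.sum_congr rfl (g := fun _ => (1 : R)) fun r hr => by
          simp [Finset.ne_of_mem_erase hr]]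
      simp [Finset.card_erase_of_mem (Finset.mem_range.2 hv), Nat.cast_sub hB, add_comm]
    rw [pow_succ, sum_range_mul_eq, pow_succ, ← ih, Finset.sum_mul]
    refine Finset.sum_congr rfl fun i _ => ?_
    rw [← sum_digit, Finset.mul_sum]
    refine Finset.sum_congr rfl fun r hr => ?_
    have hr := Finset.mem_range.1 hr
    rw [digitCount_succ, Nat.mul_add_div hB, Nat.div_eq_of_lt hr, add_zero, Nat.mul_add_mod,
      Nat.mod_eq_of_lt hr, pow_add]

theorem sub_one_add_exp_le {B s : ℝ} (hB : 0 < B) (hs : |s| ≤ 1) :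
    B - 1 + Real.exp s ≤ B * Real.exp ((s + s ^ 2) / B) := by
  calc B - 1 + Real.exp s ≤ B * ((s + s ^ 2) / B + 1) := by
        rw [mul_add, mul_div_cancel₀ _ hB.ne']
        linarith [(abs_le.1 (Real.abs_exp_sub_one_sub_id_le hs)).2]
    _ ≤ B * Real.exp ((s + s ^ 2) / B) := by gcongr; exact Real.add_one_le_exp _

/-- Chernoff's bound, by the exponential tilt `s = ε / 2`. -/
theorem card_filter_le_digitCount_le {B v : ℕ} (hv : v < B) {ε : ℝ} (h0 : 0 ≤ ε) (h1 : ε ≤ 1)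
    (T : ℕ) :
    (((Finset.range (B ^ T)).filter fun a => (1 / B + ε) * T ≤ digitCount B v T a).card : ℝ) ≤
      B ^ T * Real.exp (-(ε ^ 2 * T / 4)) := by
  set S := (Finset.range (B ^ T)).filter fun a => (1 / B + ε) * T ≤ digitCount B v T a
  set s := ε / 2 with hs
  have hB : (1 : ℝ) ≤ B := by exact_mod_cast (by omega : 1 ≤ B)
  have markov : S.card * Real.exp (s * ((1 / B + ε) * T)) ≤ (B - 1 + Real.exp s) ^ T := by
    rw [← sum_pow_digitCount hv, ← nsmul_eq_mul, ← Finset.sum_const]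
    refine (Finset.sum_le_sum fun a ha => ?_).trans
      (Finset.sum_le_sum_of_subset_of_nonneg (Finset.filter_subset _ _) fun _ _ _ => by positivity)
    rw [← Real.exp_nat_mul, mul_comm _ s]
    gcongr
    exact (Finset.mem_filter.1 ha).2
  have tilt : (B - 1 + Real.exp s) ^ T ≤ B ^ T * Real.exp (T * ((s + s ^ 2) / B)) := by
    rw [Real.exp_nat_mul, ← mul_pow]
    exact pow_le_pow_left₀ (by positivity) (sub_one_add_exp_le (by positivity)
      (abs_le.2 ⟨by linarith, by linarith⟩)) T
  calc (S.card : ℝ)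
      = S.card * Real.exp (s * ((1 / B + ε) * T)) * Real.exp (-(s * ((1 / B + ε) * T))) := by
        rw [mul_assoc, ← Real.exp_add, add_neg_cancel, Real.exp_zero, mul_one]
    _ ≤ B ^ T * Real.exp (T * ((s + s ^ 2) / B)) * Real.exp (-(s * ((1 / B + ε) * T))) :=
        mul_le_mul_of_nonneg_right (markov.trans tilt) (Real.exp_pos _).le
    _ = B ^ T * Real.exp (T * (s ^ 2 / B - s * ε)) := by
        rw [mul_assoc, ← Real.exp_add]
        ring_nf
    _ ≤ B ^ T * Real.exp (T * (s ^ 2 - s * ε)) := by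
        gcongr
        exact div_le_self (sq_nonneg s) hB
    _ = B ^ T * Real.exp (-(ε ^ 2 * T / 4)) := by
        rw [hs]
        ring_nf

/-- The numbers below `B ^ T` among whose `T` base-`B` digits the digit `v` has frequency at least
`1 / B + 1 / M`; the inequality is cleared of denominators to make the list computable. -/
def frequentList (B v M T : ℕ) : List ℕ :=
  (List.range (B ^ T)).filter fun a => (B + M) * T ≤ B * M * digitCount B v T a

theorem primrec_frequentList (B v M : ℕ) : Primrec (frequentList B v M) := by
  refine primrec_list_filter (p := fun T a => (B + M) * T ≤ B * M * digitCount B v T a)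
    (Primrec.list_range.comp (primrec_nat_pow.comp (Primrec.const B) Primrec.id))
    (Primrec.nat_le.comp (Primrec.nat_mul.comp (Primrec.const (B + M)) Primrec.fst)
      (Primrec.nat_mul.comp (Primrec.const (B * M)) (primrec_digitCount B v)))

theorem le_mul_digitCount_iff {B M : ℕ} (hB : 0 < B) (hM : 0 < M) (v T a : ℕ) :
    (B + M) * T ≤ B * M * digitCount B v T a ↔
      (1 / B + 1 / M : ℝ) * T ≤ digitCount B v T a := by
  have hB' : (0 : ℝ) < B := by exact_mod_cast hB
  have hM' : (0 : ℝ) < M := by exact_mod_cast hM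
  rw [← Nat.cast_le (α := ℝ), ← mul_le_mul_iff_right₀ (mul_pos hB' hM')]
  push_cast
  field_simp
  rw [add_comm, mul_comm (T : ℝ)]

theorem four_pow_mul_length_frequentList_le {B v M : ℕ} (hv : v < B) (hM : 0 < M) (m : ℕ) :
    4 ^ m * (frequentList B v M (8 * M ^ 2 * m)).length ≤ B ^ (8 * M ^ 2 * m) := by
  set T := 8 * M ^ 2 * m with hT
  have hM' : (1 : ℝ) ≤ M := by exact_mod_cast hM
  have length_eq : (frequentList B v M T).length =
      ((Finset.range (B ^ T)).filter fun a =>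
        (1 / B + 1 / M : ℝ) * T ≤ digitCount B v T a).card := by
    rw [frequentList, ← List.toFinset_card_of_nodup (List.nodup_range.filter _)]
    congr 1
    ext a
    simp [le_mul_digitCount_iff (Nat.zero_lt_of_lt hv) hM]
  have exp_eq : Real.exp (-((1 / M : ℝ) ^ 2 * T / 4)) = (Real.exp 1 ^ 2)⁻¹ ^ m := by
    rw [← Real.exp_nat_mul, ← Real.exp_neg, ← Real.exp_nat_mul, hT]
    push_cast
    field_simp
    ring_nf
  have hexp : (4 : ℝ) ≤ Real.exp 1 ^ 2 := by
    nlinarith [Real.add_one_le_exp 1]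
  have hcard := card_filter_le_digitCount_le hv (by positivity)
    (div_le_one_of_le₀ hM' M.cast_nonneg) T
  rw [← length_eq, exp_eq] at hcard
  have : (4 ^ m * (frequentList B v M T).length : ℝ) ≤ B ^ T := by
    calc (4 ^ m * (frequentList B v M T).length : ℝ)
        ≤ 4 ^ m * (B ^ T * (4⁻¹) ^ m) := by
          gcongr
          exact hcard.trans (by gcongr)
      _ = B ^ T := by
        rw [inv_pow]
        field_simp
  exact_mod_cast this

end DigitCount

/-- The upper density of the counting function `f`, the `limsup` of `f N / N`, is at most `P`. -/
def UpperDensityLE (f : ℕ → ℕ) (P : ℝ) : Prop :=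
  ∀ a > P, ∀ᶠ N in atTop, (f N : ℝ) ≤ a * N

theorem UpperDensityLE.of_multiples {f : ℕ → ℕ} {P : ℝ} (hf : Monotone f) (hP : 0 ≤ P)
    (h : ∀ a > P, ∃ G > 0, ∀ᶠ m : ℕ in atTop, (f (G * m) : ℝ) ≤ a * (G * m : ℕ)) :
    UpperDensityLE f P := by
  intro a ha
  obtain ⟨a', hPa', ha'a⟩ := exists_between ha
  obtain ⟨G, hG, hm⟩ := h a' hPa'
  have hlarge : ∀ᶠ N : ℕ in atTop, a' * G ≤ (a - a') * N :=
    ((tendsto_natCast_atTop_atTop.const_mul_atTop (sub_pos.2 ha'a))).eventually_ge_atTop _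
  have hquot : Tendsto (fun N => N / G + 1) atTop atTop :=
    (tendsto_add_atTop_nat 1).comp (Nat.tendsto_div_const_atTop hG.ne')
  filter_upwards [hlarge, hquot.eventually hm] with N hN hfN
  have hround : N ≤ G * (N / G + 1) := (Nat.lt_mul_div_succ N hG).le
  have hround' : ((G * (N / G + 1) : ℕ) : ℝ) ≤ N + G := by
    exact_mod_cast (by rw [mul_add, mul_one]; gcongr; exact Nat.mul_div_le N G)
  calc (f N : ℝ) ≤ f (G * (N / G + 1)) := by exact_mod_cast hf hround
    _ ≤ a' * (G * (N / G + 1) : ℕ) := hfN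
    _ ≤ a' * (N + G) := by gcongr; linarith
    _ ≤ a * N := by linarith

theorem IsAlgorithmicallyRandom.upperDensityLE_count_digits {x : ℝ}
    (hx : IsAlgorithmicallyRandom x) (h0 : 0 < x) {B : ℕ} [NeZero B] (v : Fin B) :
    UpperDensityLE (Nat.count fun t => Real.digits x B t = v) (1 / B) := by
  refine .of_multiples (Nat.count_monotone _) (by positivity) fun a ha => ?_
  obtain ⟨M, hM, hMa⟩ := Real.exists_nat_pos_inv_lt (sub_pos.2 ha)
  have hT : Primrec fun m => 8 * M ^ 2 * m := Primrec.nat_mul.comp (Primrec.const _) Primrec.id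
  refine ⟨8 * M ^ 2, by positivity, ?_⟩
  filter_upwards [hx.eventually_floor_mod_notMem h0 ((primrec_frequentList B v M).comp hT)
    (primrec_nat_pow.comp (Primrec.const B) hT) (fun m => pow_pos (NeZero.pos B) _)
    (four_pow_mul_length_frequentList_le v.2 hM)] with m hm
  set T := 8 * M ^ 2 * m
  have hcount : (digitCount B v T ⌊x * (B : ℝ) ^ T⌋₊ : ℝ) < (1 / B + 1 / M) * T := by
    contrapose! hm
    rw [frequentList, List.mem_filter, List.mem_range, decide_eq_true_iff,
      le_mul_digitCount_iff (NeZero.pos B) hM, digitCount_mod]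
    push_cast
    exact ⟨Nat.mod_lt _ (pow_pos (NeZero.pos B) _), hm⟩
  rw [digitCount_floor] at hcount
  calc (Nat.count (fun t => Real.digits x B t = v) T : ℝ) ≤ (1 / B + 1 / M) * T := hcount.le
    _ ≤ a * T := by
      gcongr
      rw [one_div (M : ℝ)]
      linarith

section Blocks

variable {b k : ℕ}

theorem floor_mul_pow_mod_pow [NeZero b] (x : ℝ) (i k : ℕ) :
    ⌊x * (b : ℝ) ^ (i + k)⌋₊ % b ^ k =
      ∑ j : Fin k, (Real.digits x b (i + j.rev) : ℕ) * b ^ (j : ℕ) := by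
  induction k with
  | zero => simp [Nat.mod_one]
  | succ k ih =>
    rw [pow_succ', Nat.mod_mul, ← add_assoc, floor_mul_pow_succ_div, ih, Fin.sum_univ_succ,
      Finset.mul_sum]
    congr 1
    · simp [Real.digits]
    · refine Finset.sum_congr rfl fun j _ => ?_
      rw [Fin.rev_succ, Fin.val_castSucc, Fin.val_succ, pow_succ]
      ring

theorem digits_pow_mul_base_pow [NeZero b] (x : ℝ) (r t : ℕ) :
    Real.digits ((b ^ r : ℕ) * x) (b ^ k) t =
      finFunctionFinEquiv fun j : Fin k => Real.digits x b (k * t + r + j.rev) := by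
  rw [Fin.ext_iff, finFunctionFinEquiv_apply, ← floor_mul_pow_mod_pow, Real.digits, Fin.val_ofNat]
  congr 2
  push_cast
  ring

theorem count_mul (p : ℕ → Prop) [DecidablePred p] (k n : ℕ) :
    Nat.count p (k * n) = ∑ r ∈ Finset.range k, Nat.count (fun t => p (k * t + r)) n := by
  simp only [Nat.count_eq_card_filter_range, Finset.card_filter]
  rw [mul_comm, sum_range_mul_eq, Finset.sum_comm]

theorem blockCount_eq_count (d : ℕ → Fin b) (w : Fin k → Fin b) :
    blockCount d w = Nat.count fun i => ∀ j : Fin k, d (i + j) = w j :=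
  funext fun _ => (Nat.count_eq_card_filter_range _ _).symm

theorem sum_blockCount (d : ℕ → Fin b) (N : ℕ) :
    ∑ w : Fin k → Fin b, blockCount d w N = N := by
  conv_rhs => rw [← Finset.card_range N, Finset.card_eq_sum_card_fiberwise
    (t := Finset.univ) (f := fun i => fun j : Fin k => d (i + j)) (fun _ _ => by simp)]
  simp only [blockCount, funext_iff]

theorem blockCount_digits_mul [NeZero b] (x : ℝ) (w : Fin k → Fin b) (m : ℕ) :
    blockCount (Real.digits x b) w (k * m) = ∑ r ∈ Finset.range k,
      Nat.count (fun t => Real.digits ((b ^ r : ℕ) * x) (b ^ k) t =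
        finFunctionFinEquiv fun j => w j.rev) m := by
  rw [blockCount_eq_count, count_mul]
  simp only [digits_pow_mul_base_pow, EmbeddingLike.apply_eq_iff_eq, funext_iff]
  simp only [Fin.rev_surjective.forall (p := fun j => Real.digits x b _ = w j)]

theorem IsAlgorithmicallyRandom.upperDensityLE_blockCount {x : ℝ}
    (hx : IsAlgorithmicallyRandom x) (h0 : 0 < x) [NeZero b] (w : Fin k → Fin b) :
    UpperDensityLE (blockCount (Real.digits x b) w) (1 / (b : ℝ) ^ k) := by
  have hb : 0 < b := NeZero.pos b
  obtain rfl | hk := Nat.eq_zero_or_pos k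
  · intro a ha
    refine .of_forall fun N => ?_
    simp only [blockCount, IsEmpty.forall_iff, Finset.filter_true, Finset.card_range]
    exact le_mul_of_one_le_left N.cast_nonneg (by simpa using ha.le)
  refine .of_multiples (blockCount_eq_count _ w ▸ Nat.count_monotone _) (by positivity)
    fun a ha => ⟨k, hk, ?_⟩
  have hdigit : ∀ᶠ m : ℕ in atTop, ∀ r ∈ Finset.range k,
      (Nat.count (fun t => Real.digits ((b ^ r : ℕ) * x) (b ^ k) t =
        finFunctionFinEquiv fun j => w j.rev) m : ℝ) ≤ a * m :=
    (eventually_all_finset _).2 fun r _ =>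
      (hx.natCast_mul (pow_pos hb r)).upperDensityLE_count_digits (by positivity) _ a
        (by simpa using ha)
  filter_upwards [hdigit] with m hm
  rw [blockCount_digits_mul, Nat.cast_sum]
  calc _ ≤ ∑ _ ∈ Finset.range k, a * (m : ℝ) := Finset.sum_le_sum hm
    _ = a * (k * m : ℕ) := by
      simp only [Finset.sum_const, Finset.card_range, nsmul_eq_mul, Nat.cast_mul]
      ring

end Blocks

theorem UpperDensityLE.tendsto_div {ι : Type*} [Fintype ι] {f : ι → ℕ → ℕ} {P : ι → ℝ}
    (h : ∀ i, UpperDensityLE (f i) (P i)) (hf : ∀ N, ∑ i, f i N = N) (hP : ∑ i, P i = 1) (i : ι) :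
    Tendsto (fun N : ℕ => (f i N : ℝ) / N) atTop (𝓝 (P i)) := by
  refine tendsto_order.2 ⟨fun a ha => ?_, fun a ha => ?_⟩
  · have : Nonempty ι := ⟨i⟩
    obtain ⟨ε, hε, hεa⟩ : ∃ ε > 0, Fintype.card ι * ε < P i - a :=
      ⟨(P i - a) / (2 * Fintype.card ι), by have := sub_pos.2 ha; positivity, by
        field_simp; linarith⟩
    filter_upwards [eventually_all.2 fun j => h j (P j + ε) (by linarith), eventually_gt_atTop 0]
      with N hN hN0
    have hN0' : (0 : ℝ) < N := by exact_mod_cast hN0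
    have hgap : (P i + ε) * N - f i N ≤ Fintype.card ι * ε * N := by
      calc (P i + ε) * N - f i N ≤ ∑ j, ((P j + ε) * N - f j N) :=
            Finset.single_le_sum (f := fun j => (P j + ε) * N - f j N)
              (fun j _ => sub_nonneg.2 (hN j)) (Finset.mem_univ i)
        _ = Fintype.card ι * ε * N := by
            rw [Finset.sum_sub_distrib, ← Finset.sum_mul, Finset.sum_add_distrib, hP,
              ← Nat.cast_sum, hf, Finset.sum_const, Finset.card_univ, nsmul_eq_mul]
            ring
    rw [lt_div_iff₀ hN0']
    nlinarith
  · obtain ⟨a', hPa', ha'a⟩ := exists_between ha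
    filter_upwards [h i a' hPa', eventually_gt_atTop 0] with N hN hN0
    exact ((div_le_iff₀ (by exact_mod_cast hN0)).2 hN).trans_lt ha'a

theorem IsAlgorithmicallyRandom.isBorelNormal {x : ℝ} (hx : IsAlgorithmicallyRandom x)
    (h0 : 0 < x) : IsBorelNormal x := by
  intro b _ _ k w
  refine UpperDensityLE.tendsto_div (f := blockCount (Real.digits x b))
    (fun w => hx.upperDensityLE_blockCount h0 w) (sum_blockCount _) ?_ w
  simp [NeZero.ne]

theorem mainTheorem6 (U : List Bool →. List Bool) (hU : IsUniversalComputer U) :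
    Summable (programProbability U) ∧
      0 < haltingProbability U ∧ haltingProbability U < 1 ∧
      IsBorelNormal (haltingProbability U) := by
  have hrandom := hU.isAlgorithmicallyRandom
  have hpos := hU.selfDelimiting.haltingProbability_pos hU.dom_nonempty
  have hne : haltingProbability U ≠ 1 := (hrandom.irrational hpos).ne_one
  exact ⟨hU.selfDelimiting.summable, hpos,
    hU.selfDelimiting.haltingProbability_le_one.lt_of_ne hne, hrandom.isBorelNormal hpos⟩
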